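/- For a commutative ring $R$ with $1\neq 0$ let $I(R)^*$ be the set of its non-trivial ideals, i.e. the ideals $I$ with $I\ne 0$ and $I\ne R$. For a non-zero unitary $R$-module $M$, let $G_M(R)$ be the graph with vertex set $I(R)^*$ in which two distinct vertices $I,J$ are adjacent if and only if $IM\cap JM\neq 0$; let $G(R)$ be the graph with vertex set $I(R)^*$ in which two distinct vertices $I,J$ are adjacent if and only if $I\cap J\ne 0$. A finite graph is called perfect if every induced subgraph $H$ of it satisfies $\chi(H)=\omega(H)$, where $\chi$ is the chromatic number and $\omega$ the clique number. Let $n,m\ge 2$ be integers and let $\mathbb{Z}_n=\mathbb{Z}/n\mathbb{Z}$ be a module over the ring $\mathbb{Z}_m=\mathbb{Z}/m\mathbb{Z}$. Then $n\mid m$, and the graph $G_n(\mathbb{Z}_m):=G_{\mathbb{Z}_n}(\mathbb{Z}_m)$ is perfect if and only if $n$ has at most four distinct prime divisors. Moreover, for every integer $m\ge 2$, the graph $G(\mathbb{Z}_m)$ is perfect if and only if $m$ has at most four distinct prime divisors. -/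

import Mathlib

/-- The set of nontrivial ideals of `R`: the ideals other than `0` and `R`. -/
abbrev NontrivialIdeal (R : Type*) [CommRing R] : Type _ :=
  {I : Ideal R // I ≠ ⊥ ∧ I ≠ ⊤}

/-- The `M`-intersection graph of ideals of `R`: the vertices are the nontrivial ideals of `R`, and
distinct `I`, `J` are adjacent if and only if `IM ∩ JM ≠ 0`. -/
def moduleIntersectionGraph (R M : Type*) [CommRing R] [AddCommGroup M] [Module R M] :
    SimpleGraph (NontrivialIdeal R) where
  Adj I J := I ≠ J ∧ (I.1 • (⊤ : Submodule R M)) ⊓ (J.1 • (⊤ : Submodule R M)) ≠ ⊥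
  symm := ⟨fun _ _ h => ⟨h.1.symm, by rw [inf_comm]; exact h.2⟩⟩
  loopless := ⟨fun _ h => h.1 rfl⟩

/-- The intersection graph of ideals of `R`: the vertices are the nontrivial ideals of `R`, and
distinct `I`, `J` are adjacent if and only if `I ∩ J ≠ 0`. -/
def idealIntersectionGraph (R : Type*) [CommRing R] : SimpleGraph (NontrivialIdeal R) where
  Adj I J := I ≠ J ∧ I.1 ⊓ J.1 ≠ ⊥
  symm := ⟨fun _ _ h => ⟨h.1.symm, by rw [inf_comm]; exact h.2⟩⟩
  loopless := ⟨fun _ h => h.1 rfl⟩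

/-- A (finite) graph is perfect if the chromatic number of every induced subgraph equals its
clique number. Finiteness of the vertex type makes `cliqueNum` the size of a largest clique. -/
def IsPerfectGraph {V : Type*} [Finite V] (G : SimpleGraph V) : Prop :=
  ∀ s : Set V, (G.induce s).chromaticNumber = ((G.induce s).cliqueNum : ℕ∞)

/-! Label a submodule `N` of `ZMod n` by the primes `p ∣ n` with `n / p ∈ N`. Labels commute with
intersection and are empty only for `N = ⊥`, so ideals are adjacent iff the labels of their images
meet. With five primes `p i`, the ideals generated by `n / (p i * p (i + 1))`, indices mod 5, induce
a 5-cycle, which is not perfect. With at most four, labels embed in `Fin 4`, and every such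
intersection graph is coloured with `cliqueNum` colours: labels of size at least two first, then
singletons; induced subgraphs have the same form. -/

open Finset in
theorem exists_mapsTo_injOn_of_card_le {α β : Type*} [Nonempty β] (s : Finset α) (t : Finset β)
    (h : #s ≤ #t) : ∃ f : α → β, (∀ a ∈ s, f a ∈ t) ∧ Set.InjOn f s := by
  obtain ⟨f, hf, hinj⟩ := s.finite_toSet.exists_injOn_of_encard_le (β := β) (t := (t : Set β))
    (by simpa using h)
  exact ⟨f, fun a ha => hf ha, hinj⟩

/-! ### Colouring intersection graphs of subsets of a four-element set -/

section Coloring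

open Finset

variable {V : Type*} [Fintype V] (f : V → Finset (Fin 4))

/-- Among two complementary sets, the one that more vertices are labelled with, ties being broken
in favour of the set containing `0`. -/
def IsDominant (S : Finset (Fin 4)) : Prop :=
  #{v | f v = Sᶜ} < #{v | f v = S} ∨ (#{v | f v = Sᶜ} = #{v | f v = S} ∧ 0 ∈ S)

theorem IsDominant.not_compl {S : Finset (Fin 4)} (h : IsDominant f S) : ¬ IsDominant f Sᶜ := by
  unfold IsDominant at *
  simp only [compl_compl, mem_compl] at *
  rintro (h' | h') <;> rcases h with h | h
  · omega
  · omega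
  · omega
  · exact h'.2 h.2

theorem isDominant_compl_of_not {S : Finset (Fin 4)} (h : ¬ IsDominant f S) :
    IsDominant f Sᶜ ∧ #{v | f v = S} ≤ #{v | f v = Sᶜ} := by
  unfold IsDominant at *
  simp only [compl_compl, mem_compl] at *
  push Not at h
  refine ⟨?_, h.1⟩
  rcases h.1.lt_or_eq with h' | h'
  · exact Or.inl h'
  · exact Or.inr ⟨h', h.2 h'.symm⟩

theorem eq_compl_of_disjoint_of_two_le_card {S T : Finset (Fin 4)} (h : Disjoint S T)
    (hS : 2 ≤ #S) (hT : 2 ≤ #T) : #S = 2 ∧ #T = 2 ∧ T = Sᶜ := by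
  have h1 := card_union_of_disjoint h
  have h2 : #(S ∪ T) ≤ 4 := by simpa using card_le_univ (S ∪ T)
  have hc := card_compl S
  rw [Fintype.card_fin] at hc
  refine ⟨by omega, by omega, eq_of_subset_of_card_le ?_ (by omega)⟩
  intro x hx
  exact mem_compl.2 fun hxS => disjoint_left.1 h hxS hx

variable {f} {G : SimpleGraph V}

/-- Large labels are disjoint only when they are complementary pairs. Keeping the more frequent
label of each complementary pair leaves a clique; the vertices dropped reuse the colours of their
complements. -/
theorem exists_coloring_of_two_le_card [Nonempty V]
    (hG : ∀ u v, G.Adj u v ↔ u ≠ v ∧ ¬ Disjoint (f u) (f v)) :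
    ∃ c : V → Fin G.cliqueNum, ∀ u v, 2 ≤ #(f u) → 2 ≤ #(f v) → G.Adj u v → c u ≠ c v := by
  classical
  have hpos : 0 < G.cliqueNum := by
    have h : G.IsClique (({Classical.arbitrary V} : Finset V) : Set V) := by simp
    simpa using! h.card_le_cliqueNum
  have : Nonempty (Fin G.cliqueNum) := ⟨⟨0, hpos⟩⟩
  set C : Finset V := {v | 2 ≤ #(f v) ∧ (#(f v) = 2 → IsDominant f (f v))} with hC
  have hclique : G.IsClique (C : Set V) := by
    intro u hu v hv huv
    simp only [hC, coe_filter, mem_univ, true_and, Set.mem_ofPred_eq] at hu hv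
    refine (hG u v).2 ⟨huv, fun hd => ?_⟩
    obtain ⟨h1, h2, h3⟩ := eq_compl_of_disjoint_of_two_le_card hd hu.1 hv.1
    exact (hu.2 h1).not_compl f (h3 ▸ hv.2 h2)
  obtain ⟨ι, -, hι⟩ := exists_mapsTo_injOn_of_card_le C (univ : Finset (Fin G.cliqueNum))
    (by simpa using hclique.card_le_cliqueNum)
  -- Dominance supplies enough vertices labelled `Sᶜ` to match those labelled `S` injectively.
  have hg : ∀ S : Finset (Fin 4), ∃ g : V → V, ¬ IsDominant f S →
      (∀ v, f v = S → f (g v) = Sᶜ) ∧ Set.InjOn g {v | f v = S} := by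
    intro S
    by_cases hS : IsDominant f S
    · exact ⟨id, fun h => absurd hS h⟩
    · obtain ⟨g, h1, h2⟩ := exists_mapsTo_injOn_of_card_le _ _ (isDominant_compl_of_not f hS).2
      exact ⟨g, fun _ => ⟨by simpa using h1, by simpa using h2⟩⟩
  choose g hg using hg
  have hout : ∀ v, 2 ≤ #(f v) → v ∉ C → ¬ IsDominant f (f v) ∧ g (f v) v ∈ C ∧
      f (g (f v) v) = (f v)ᶜ := by
    intro v hv hvC
    simp only [hC, mem_filter, mem_univ, true_and, not_and, Classical.not_imp] at hvC
    obtain ⟨h2, hd⟩ := hvC hv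
    have hgv := (hg _ hd).1 v rfl
    refine ⟨hd, ?_, hgv⟩
    simp only [hC, mem_filter, mem_univ, true_and, hgv]
    refine ⟨?_, fun _ => (isDominant_compl_of_not f hd).1⟩
    rw [card_compl, Fintype.card_fin]
    omega
  -- A shared colour would force `u` to be the partner of `v`, whose label is disjoint from that of
  -- `v`.
  have key : ∀ u v, u ∈ C → 2 ≤ #(f v) → v ∉ C → G.Adj u v → ι u ≠ ι (g (f v) v) := by
    intro u v hu hv hvC hadj he
    obtain ⟨-, h2, h3⟩ := hout v hv hvC
    have := hι hu h2 he
    rw [← this] at h3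
    exact ((hG u v).1 hadj).2 (h3 ▸ disjoint_compl_left)
  refine ⟨fun v => if v ∈ C then ι v else ι (g (f v) v), fun u v hu hv hadj => ?_⟩
  by_cases huC : u ∈ C <;> by_cases hvC : v ∈ C <;> simp only [huC, hvC, if_true, if_false]
  · exact fun he => hadj.ne (hι huC hvC he)
  · exact key u v huC hv hvC hadj
  · exact (key v u hvC hu huC hadj.symm).symm
  · intro he
    obtain ⟨hd, hu2, hu3⟩ := hout u hu huC
    obtain ⟨-, hv2, hv3⟩ := hout v hv hvC
    have heq := hι hu2 hv2 he
    have hfe : f u = f v := by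
      rw [heq, hv3] at hu3
      exact (compl_injective hu3).symm
    rw [← hfe] at heq
    exact hadj.ne ((hg _ hd).2 rfl hfe.symm heq)

theorem colorable_cliqueNum_of_adj_iff
    (hG : ∀ u v, G.Adj u v ↔ u ≠ v ∧ ¬ Disjoint (f u) (f v)) : G.Colorable G.cliqueNum := by
  classical
  cases isEmpty_or_nonempty V
  · exact SimpleGraph.Colorable.of_isEmpty _
  obtain ⟨c, hc⟩ := exists_coloring_of_two_le_card hG
  have : Nonempty (Fin G.cliqueNum) := ⟨c (Classical.arbitrary V)⟩
  have hg : ∀ i : Fin 4, ∃ g : V → Fin G.cliqueNum,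
      (∀ v, f v = {i} → ∀ u, 2 ≤ #(f u) → i ∈ f u → g v ≠ c u) ∧
      Set.InjOn g {v | f v = {i}} := by
    intro i
    -- All labels in `A ∪ B` contain `i`, so this is a clique, and the colours unused on `A` suffice
    -- for `B`.
    set A : Finset V := {u | 2 ≤ #(f u) ∧ i ∈ f u} with hA
    set B : Finset V := {v | f v = {i}} with hB
    have hdisj : Disjoint A B := by
      rw [disjoint_left]
      intro v hvA hvB
      simp only [hA, hB, mem_filter, mem_univ, true_and] at hvA hvB
      rw [hvB, card_singleton] at hvA
      omega
    have hclique : G.IsClique ((A ∪ B : Finset V) : Set V) := by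
      have hmem : ∀ v ∈ A ∪ B, i ∈ f v := by
        intro v hv
        simp only [hA, hB, mem_union, mem_filter, mem_univ, true_and] at hv
        rcases hv with hv | hv
        · exact hv.2
        · simp [hv]
      intro u hu v hv huv
      exact (hG u v).2 ⟨huv, not_disjoint_iff.2 ⟨i, hmem u hu, hmem v hv⟩⟩
    have h1 : #(A ∪ B) ≤ G.cliqueNum := hclique.card_le_cliqueNum
    rw [card_union_of_disjoint hdisj] at h1
    have h2 : #(A.image c) ≤ #A := card_image_le
    have h3 := card_compl (A.image c)
    rw [Fintype.card_fin] at h3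
    obtain ⟨g, hg1, hg2⟩ := exists_mapsTo_injOn_of_card_le B (A.image c)ᶜ (by omega)
    refine ⟨g, fun v hv u hu hiu he => ?_, by simpa [hB] using hg2⟩
    exact mem_compl.1 (hg1 v (by simpa [hB] using hv))
      (he ▸ mem_image_of_mem c (by simpa [hA] using ⟨hu, hiu⟩))
  choose g hg1 hg2 using hg
  have hcol : ∀ v, ∃ a : Fin G.cliqueNum, (2 ≤ #(f v) → a = c v) ∧
      ∀ i, f v = {i} → a = g i v := by
    intro v
    by_cases hv : 2 ≤ #(f v)
    · refine ⟨c v, fun _ => rfl, fun i hi => ?_⟩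
      rw [hi, card_singleton] at hv
      omega
    · by_cases hi : ∃ i, f v = {i}
      · obtain ⟨i, hi⟩ := hi
        refine ⟨g i v, fun h => absurd h hv, fun j hj => ?_⟩
        rw [singleton_injective (hi.symm.trans hj)]
      -- An empty label makes the vertex isolated, so any colour will do.
      · exact ⟨c v, fun _ => rfl, fun i h => absurd ⟨i, h⟩ hi⟩
  choose col hcol1 hcol2 using hcol
  have hcases : ∀ u v, G.Adj u v → 2 ≤ #(f u) ∨ ∃ i, f u = {i} ∧ i ∈ f v := by
    intro u v hadj
    obtain ⟨i, hiu, hiv⟩ := not_disjoint_iff.1 ((hG u v).1 hadj).2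
    by_cases hu : 2 ≤ #(f u)
    · exact Or.inl hu
    · have h1 : #(f u) = 1 := by
        have := card_pos.2 ⟨i, hiu⟩
        omega
      obtain ⟨j, hj⟩ := card_eq_one.1 h1
      rw [hj, mem_singleton] at hiu
      exact Or.inr ⟨i, hiu ▸ hj, hiv⟩
  refine ⟨SimpleGraph.Coloring.mk col fun {u v} hadj => ?_⟩
  rcases hcases u v hadj with hu | ⟨i, hi, hiv⟩ <;>
    rcases hcases v u hadj.symm with hv | ⟨j, hj, hju⟩
  · rw [hcol1 u hu, hcol1 v hv]
    exact hc u v hu hv hadj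
  · rw [hcol1 u hu, hcol2 v j hj]
    exact (hg1 j v hj u hu hju).symm
  · rw [hcol1 v hv, hcol2 u i hi]
    exact hg1 i u hi v hv hiv
  · rw [hi, mem_singleton] at hju
    subst hju
    rw [hcol2 u j hi, hcol2 v j hj]
    exact fun he => hadj.ne (hg2 j hi hj he)

end Coloring

/-- The graph of intersections of a finite family of subsets of a four-element set is perfect. -/
theorem isPerfectGraph_of_adj_iff_not_disjoint {V : Type*} [Finite V] {G : SimpleGraph V}
    (f : V → Finset (Fin 4)) (hG : ∀ u v, G.Adj u v ↔ u ≠ v ∧ ¬ Disjoint (f u) (f v)) :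
    IsPerfectGraph G := by
  classical
  intro s
  have := Fintype.ofFinite s
  refine le_antisymm ?_ SimpleGraph.cliqueNum_le_chromaticNumber
  refine (colorable_cliqueNum_of_adj_iff (f := fun v : s => f v) fun u v => ?_).chromaticNumber_le
  simp [hG, Subtype.ext_iff]

/-- The 5-cycle has chromatic number 3 but no triangle. -/
theorem not_isPerfectGraph_of_cycleGraph_five_embedding {V : Type*} [Finite V] {G : SimpleGraph V}
    (φ : SimpleGraph.cycleGraph 5 ↪g G) : ¬ IsPerfectGraph G := by
  intro h
  have hs := h (Set.range φ)
  have e : SimpleGraph.cycleGraph 5 ≃g G.induce (Set.range φ) :=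
    { Equiv.ofInjective φ φ.injective with
      map_rel_iff' := by intro a b; simp }
  rw [← SimpleGraph.chromaticNumber_congr e,
    SimpleGraph.chromaticNumber_cycleGraph_of_odd 5 (by norm_num) (by decide)] at hs
  obtain ⟨t, ht⟩ := (G.induce (Set.range φ)).exists_isNClique_cliqueNum
  rw [← (show (3 : ℕ) = (G.induce (Set.range φ)).cliqueNum by exact_mod_cast hs)] at ht
  have hfree : (SimpleGraph.cycleGraph 5).CliqueFree 3 := by
    unfold SimpleGraph.CliqueFree
    decide
  exact (hfree.comap e.symm.isContained) t ht

/-! ### Prime supports of submodules of `ZMod n` -/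

section Support

variable {m n : ℕ} [Module (ZMod m) (ZMod n)]

/-- The primes `p ∣ n` for which the submodule `N` of `ZMod n` has a nonzero `p`-primary part. -/
def primeSupport (N : Submodule (ZMod m) (ZMod n)) : Set ℕ :=
  {p | p ∈ n.primeFactors ∧ ((n / p : ℕ) : ZMod n) ∈ N}

theorem dvd_of_module_zmod : n ∣ m := by
  have h : ((m : ZMod m)) • (1 : ZMod n) = m • (1 : ZMod n) := Nat.cast_smul_eq_nsmul _ _ _
  rw [ZMod.natCast_self, zero_smul, nsmul_one] at h
  exact (ZMod.natCast_eq_zero_iff m n).1 h.symm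

theorem natCast_mem_of_dvd {N : Submodule (ZMod m) (ZMod n)} {a b : ℕ} (hab : a ∣ b)
    (ha : (a : ZMod n) ∈ N) : (b : ZMod n) ∈ N := by
  obtain ⟨c, rfl⟩ := hab
  rw [mul_comm, Nat.cast_mul, ← nsmul_eq_mul]
  exact N.nsmul_mem ha c

theorem primeSupport_inf (N₁ N₂ : Submodule (ZMod m) (ZMod n)) :
    primeSupport (N₁ ⊓ N₂) = primeSupport N₁ ∩ primeSupport N₂ := by
  ext p
  simp only [primeSupport, Submodule.mem_inf, Set.mem_inter_iff, Set.mem_ofPred_eq]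
  tauto

theorem primeSupport_top :
    primeSupport (⊤ : Submodule (ZMod m) (ZMod n)) = n.primeFactors := by
  ext p
  simp [primeSupport]

theorem natCast_gcd_mem {N : Submodule (ZMod m) (ZMod n)} {a : ℕ} (ha : (a : ZMod n) ∈ N) :
    ((a.gcd n : ℕ) : ZMod n) ∈ N := by
  have h : ((a.gcd n : ℕ) : ZMod n) = (a.gcdA n) • (a : ZMod n) := by
    have := congrArg (Int.cast : ℤ → ZMod n) (Nat.gcd_eq_gcd_ab a n)
    push_cast at this
    rw [this, ZMod.natCast_self, zsmul_eq_mul]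
    ring
  rw [h]
  exact N.toAddSubgroup.zsmul_mem ha _

/-- A nonzero `x ∈ N` puts a proper divisor `n / k` of `n` in `N`, namely its gcd with `n`; any
prime `p ∣ k` then gives `n / p ∈ N`. -/
theorem primeSupport_nonempty_iff [NeZero n] (N : Submodule (ZMod m) (ZMod n)) :
    (primeSupport N).Nonempty ↔ N ≠ ⊥ := by
  have hn : 0 < n := Nat.pos_of_neZero n
  constructor
  · rintro ⟨p, hp, hpN⟩ rfl
    rw [Submodule.mem_bot, ZMod.natCast_eq_zero_iff] at hpN
    have hp' := Nat.prime_of_mem_primeFactors hp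
    have hpos := Nat.div_pos (Nat.le_of_dvd hn (Nat.dvd_of_mem_primeFactors hp)) hp'.pos
    exact absurd (Nat.le_of_dvd hpos hpN) (not_le.2 (Nat.div_lt_self hn hp'.one_lt))
  · intro hN
    obtain ⟨x, hx, hx0⟩ := N.exists_mem_ne_zero_of_ne_bot hN
    have hg : ((x.val.gcd n : ℕ) : ZMod n) ∈ N := natCast_gcd_mem (by simpa using hx)
    obtain ⟨k, hk⟩ := x.val.gcd_dvd_right n
    have hk1 : k ≠ 1 := by
      rintro rfl
      rw [mul_one] at hk
      apply hx0
      have hd : n ∣ x.val := by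
        conv_lhs => rw [hk]
        exact x.val.gcd_dvd_left n
      rwa [← ZMod.natCast_eq_zero_iff, ZMod.natCast_zmod_val] at hd
    obtain ⟨p, hp, j, rfl⟩ := Nat.exists_prime_and_dvd hk1
    have hpn : p ∣ n := ⟨x.val.gcd n * j, hk.trans (by ring)⟩
    refine ⟨p, Nat.mem_primeFactors.2 ⟨hp, hpn, hn.ne'⟩, natCast_mem_of_dvd ?_ hg⟩
    refine (Nat.dvd_div_iff_mul_dvd hpn).2 ⟨j, ?_⟩
    exact hk.trans (by ring)

theorem natCast_mem_span_smul_top_iff (a b : ℕ) :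
    (b : ZMod n) ∈ Ideal.span {(a : ZMod m)} • (⊤ : Submodule (ZMod m) (ZMod n)) ↔
      ∃ x : ZMod n, (a : ZMod n) * x = b := by
  rw [Submodule.ideal_span_singleton_smul]
  simp [Submodule.mem_smul_pointwise_iff_exists, Nat.cast_smul_eq_nsmul, nsmul_eq_mul]

/-- For a prime `r ∣ n`, the number `n / (p * q)` divides `n / r` iff `r ∣ p * q`. -/
theorem primeSupport_span_smul_top [NeZero n] {p q : ℕ} (hp : p ∈ n.primeFactors)
    (hq : q ∈ n.primeFactors) (hpq : p ≠ q) :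
    primeSupport (Ideal.span {((n / (p * q) : ℕ) : ZMod m)} •
      (⊤ : Submodule (ZMod m) (ZMod n))) = {p, q} := by
  have hp' := Nat.prime_of_mem_primeFactors hp
  have hq' := Nat.prime_of_mem_primeFactors hq
  have hdvd : p * q ∣ n := ((Nat.coprime_primes hp' hq').2 hpq).mul_dvd_of_dvd_of_dvd
    (Nat.dvd_of_mem_primeFactors hp) (Nat.dvd_of_mem_primeFactors hq)
  obtain ⟨k, hk⟩ := hdvd
  have hn : 0 < n := Nat.pos_of_neZero n
  have hk0 : 0 < k := Nat.pos_of_ne_zero (by rintro rfl; omega)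
  have hdiv : n / (p * q) = k := by
    rw [hk]
    exact Nat.mul_div_cancel_left _ (Nat.mul_pos hp'.pos hq'.pos)
  have hmem : ∀ b : ℕ, (b : ZMod n) ∈ Ideal.span {(k : ZMod m)} •
      (⊤ : Submodule (ZMod m) (ZMod n)) ↔ k ∣ b := by
    intro b
    rw [natCast_mem_span_smul_top_iff]
    constructor
    · rintro ⟨x, hx⟩
      have h := hx
      rw [← ZMod.natCast_zmod_val x, ← Nat.cast_mul, ZMod.natCast_eq_natCast_iff] at h
      exact (h.dvd_iff (d := k) ⟨p * q, by rw [mul_comm]; exact hk⟩).1 (dvd_mul_right _ _)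
    · rintro ⟨c, rfl⟩
      exact ⟨c, by push_cast; rfl⟩
  rw [hdiv]
  ext r
  simp only [primeSupport, Set.mem_ofPred_eq, hmem, Set.mem_insert_iff, Set.mem_singleton_iff]
  constructor
  · rintro ⟨hr, hkr⟩
    have hr' := Nat.prime_of_mem_primeFactors hr
    rw [Nat.dvd_div_iff_mul_dvd (Nat.dvd_of_mem_primeFactors hr)] at hkr
    have h : r ∣ p * q := by
      rw [hk] at hkr
      exact Nat.dvd_of_mul_dvd_mul_right hk0 hkr
    rcases hr'.dvd_mul.1 h with h | h
    · exact Or.inl ((Nat.prime_dvd_prime_iff_eq hr' hp').1 h)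
    · exact Or.inr ((Nat.prime_dvd_prime_iff_eq hr' hq').1 h)
  · intro h
    have hr : r ∈ n.primeFactors := by rcases h with rfl | rfl <;> assumption
    refine ⟨hr, (Nat.dvd_div_iff_mul_dvd (Nat.dvd_of_mem_primeFactors hr)).2 ?_⟩
    have hrpq : r ∣ p * q := by
      rcases h with rfl | rfl
      · exact dvd_mul_right _ _
      · exact dvd_mul_left _ _
    have := Nat.mul_dvd_mul_right hrpq k
    rwa [← hk] at this

theorem moduleIntersectionGraph_adj_iff [NeZero n] (I J : NontrivialIdeal (ZMod m)) :
    (moduleIntersectionGraph (ZMod m) (ZMod n)).Adj I J ↔ I ≠ J ∧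
      (primeSupport (I.1 • (⊤ : Submodule (ZMod m) (ZMod n))) ∩
        primeSupport (J.1 • (⊤ : Submodule (ZMod m) (ZMod n)))).Nonempty := by
  rw [← primeSupport_inf, primeSupport_nonempty_iff]
  rfl

theorem isPerfectGraph_of_card_primeFactors_le [NeZero m] [NeZero n]
    (h : n.primeFactors.card ≤ 4) :
    IsPerfectGraph (moduleIntersectionGraph (ZMod m) (ZMod n)) := by
  classical
  obtain ⟨e, -, he⟩ := exists_mapsTo_injOn_of_card_le n.primeFactors
    (Finset.univ : Finset (Fin 4)) (by simpa using h)
  refine isPerfectGraph_of_adj_iff_not_disjoint (fun I => Finset.univ.filter fun i =>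
    ∃ p ∈ primeSupport (I.1 • (⊤ : Submodule (ZMod m) (ZMod n))), e p = i) fun I J => ?_
  rw [moduleIntersectionGraph_adj_iff, Finset.not_disjoint_iff]
  refine and_congr_right fun _ => ?_
  simp only [Finset.mem_filter, Finset.mem_univ, true_and]
  constructor
  · rintro ⟨p, hp, hq⟩
    exact ⟨e p, ⟨p, hp, rfl⟩, ⟨p, hq, rfl⟩⟩
  · rintro ⟨_, ⟨p, hp, rfl⟩, ⟨q, hq, hpq⟩⟩
    rw [he hq.1 hp.1 hpq] at hq
    exact ⟨p, hp, hq⟩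

theorem card_primeFactors_le_of_isPerfectGraph [NeZero m] [NeZero n]
    (h : IsPerfectGraph (moduleIntersectionGraph (ZMod m) (ZMod n))) :
    n.primeFactors.card ≤ 4 := by
  classical
  by_contra! hcard
  obtain ⟨t, hts, ht⟩ := Finset.exists_subset_card_eq (Nat.succ_le_of_lt hcard)
  obtain ⟨p, hinj, hmem⟩ : ∃ p : Fin 5 → ℕ, Function.Injective p ∧ ∀ i, p i ∈ n.primeFactors :=
    ⟨fun i => (t.equivFinOfCardEq ht).symm i,
      Subtype.val_injective.comp (t.equivFinOfCardEq ht).symm.injective,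
      fun i => hts ((t.equivFinOfCardEq ht).symm i).2⟩
  have hne : ∀ i, p i ≠ p (i + 1) := fun i hi => by
    have h1 := hinj hi
    clear hi
    revert i
    decide
  set I : Fin 5 → Ideal (ZMod m) := fun i =>
    Ideal.span {((n / (p i * p (i + 1)) : ℕ) : ZMod m)} with hI
  have hsupp : ∀ i, primeSupport (I i • (⊤ : Submodule (ZMod m) (ZMod n))) = {p i, p (i + 1)} :=
    fun i => primeSupport_span_smul_top (hmem _) (hmem _) (hne i)
  have hbot : ∀ i, I i ≠ ⊥ := by
    intro i hi
    have h1 := (primeSupport_nonempty_iff (I i • (⊤ : Submodule (ZMod m) (ZMod n)))).1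
      (by rw [hsupp]; exact ⟨p i, by simp⟩)
    rw [hi] at h1
    simp at h1
  have htop : ∀ i, I i ≠ ⊤ := by
    intro i hi
    have h1 := hsupp i
    rw [hi, Submodule.top_smul, primeSupport_top] at h1
    -- The unit ideal would have full support, yet a third prime is missing.
    have h2 : p (i + 2) ∈ ({p i, p (i + 1)} : Set ℕ) := h1 ▸ hmem _
    simp only [Set.mem_insert_iff, Set.mem_singleton_iff, hinj.eq_iff] at h2
    clear hi h1
    revert i
    decide
  have hInj : Function.Injective I := by
    intro i j hij
    have h1 : ({p i, p (i + 1)} : Set ℕ) = {p j, p (j + 1)} := by rw [← hsupp, ← hsupp, hij]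
    have h2 : p i ∈ ({p j, p (j + 1)} : Set ℕ) := h1 ▸ by simp
    have h3 : p (i + 1) ∈ ({p j, p (j + 1)} : Set ℕ) := h1 ▸ by simp
    simp only [Set.mem_insert_iff, Set.mem_singleton_iff, hinj.eq_iff] at h2 h3
    clear h1 hij
    revert i j
    decide
  refine not_isPerfectGraph_of_cycleGraph_five_embedding
    (G := moduleIntersectionGraph (ZMod m) (ZMod n))
    ⟨⟨fun i => ⟨I i, hbot i, htop i⟩, fun i j hij => hInj (congrArg Subtype.val hij)⟩,
      fun {i j} => ?_⟩ h
  change (moduleIntersectionGraph (ZMod m) (ZMod n)).Adj ⟨I i, hbot i, htop i⟩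
    ⟨I j, hbot j, htop j⟩ ↔ _
  rw [moduleIntersectionGraph_adj_iff, hsupp, hsupp, Ne, Subtype.mk.injEq, hInj.eq_iff]
  have hint : (({p i, p (i + 1)} ∩ {p j, p (j + 1)} : Set ℕ)).Nonempty ↔
      (i = j ∨ i = j + 1) ∨ (i + 1 = j ∨ i + 1 = j + 1) := by
    simp [Set.Nonempty, hinj.eq_iff, or_and_right, exists_or]
  rw [hint]
  clear hint
  revert i j
  decide

end Support

theorem idealIntersectionGraph_eq_moduleIntersectionGraph (R : Type*) [CommRing R] :
    idealIntersectionGraph R = moduleIntersectionGraph R R := by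
  ext I J
  simp [idealIntersectionGraph, moduleIntersectionGraph, Ideal.mul_top]

theorem mainTheorem1 :
    (∀ (n m : ℕ) [NeZero m] [Module (ZMod m) (ZMod n)], 2 ≤ n → 2 ≤ m →
      n ∣ m ∧
      (IsPerfectGraph (moduleIntersectionGraph (ZMod m) (ZMod n)) ↔ n.primeFactors.card ≤ 4)) ∧
    (∀ (m : ℕ) [NeZero m], 2 ≤ m →
      (IsPerfectGraph (idealIntersectionGraph (ZMod m)) ↔ m.primeFactors.card ≤ 4)) := by
  have key : ∀ (n m : ℕ) [NeZero m] [NeZero n] [Module (ZMod m) (ZMod n)],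
      IsPerfectGraph (moduleIntersectionGraph (ZMod m) (ZMod n)) ↔ n.primeFactors.card ≤ 4 :=
    fun n m => ⟨card_primeFactors_le_of_isPerfectGraph, isPerfectGraph_of_card_primeFactors_le⟩
  refine ⟨fun n m _ _ hn _ => ?_, fun m _ _ => ?_⟩
  · have : NeZero n := ⟨by omega⟩
    exact ⟨dvd_of_module_zmod, key n m⟩
  · rw [idealIntersectionGraph_eq_moduleIntersectionGraph]
    exact key m m
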